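/- **Setting.** Let $n,d,m\in\mathbb N$, and let $G$ be a directed acyclic graph (DAG) on $[n]$. A *causal model* over $G$ consists of causal mechanisms, that is, conditional densities $p_i(v_i\mid v_{\mathrm{pa}(i)})$, $i\in[n]$, where $\mathrm{pa}(i)$ is the set of parents of $i$ in $G$; it induces the distribution $P_V$ on $\mathbb R^n$ with density $p(v)=\prod_{i}p_i(v_i\mid v_{\mathrm{pa}(i)})$. It is *faithful* if the only conditional independences $V_A\perp V_B\mid V_C$ (with $A,B,C\subseteq[n]$ disjoint) satisfied by $P_V$ are those implied by the causal Markov condition, i.e. those satisfied by every distribution on $\mathbb R^n$ under which each variable is independent of its non-descendants in $G$ given its parents. A *perfect single-node intervention* on $i$ replaces $p_i(v_i\mid v_{\mathrm{pa}(i)})$ by a density $\tilde p_i(v_i)$ not depending on the parents and leaves all other mechanisms unchanged. A *mixing function* is a map $\mathbb R^n\to\mathbb R^d$ that is a ($C^1$) diffeomorphism onto its image. For unmixing functions $h_1,h_2:\mathcal X\to\mathbb R^n$ on a set $\mathcal X\subseteq\mathbb R^d$ and DAGs $G_1,G_2$ on $[n]$, write $(h_1,G_1)\sim_{\mathrm{CRL}}(h_2,G_2)$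 if there are an element-wise $C^1$-diffeomorphism $\phi(v)=(\phi_1(v_1),\dots,\phi_n(v_n))$ of $\mathbb R^n$ and a permutation $\pi$ of $[n]$ that is a graph isomorphism $G_1\to G_2$ such that $(h_2(x))_{\pi(i)}=\phi_i\big((h_1(x))_i\big)$ for all $x\in\mathcal X$ and $i\in[n]$. This is an equivalence relation. **Theorem.** Let the ground truth consist of a faithful causal model over a DAG $G$ on $[n]$ with mechanisms $p_i$ and a mixing function $f$ with image $\mathcal X=f(\mathbb R^n)$. Let $(e_j,e_j')$, $j\in[m]$, be pairs of environments such that in each pair both environments are perfect single-node interventions on one and the same (unknown) node. Let $P^e_V$ be the resulting latent distributions, $p^e$ their densities, and $P_X^e=f_*(P_V^e)$ the observed distributions. Assume that all $p^e$ are continuously differentiable and positive on $\mathbb R^n$, and that for every node $i\in[n]$ there is a pair $j$ whose two interventions target $i$ with intervened mechanisms $\tilde p_i$ (in $e_j$) and $\tilde{\tilde p}_i$ (in $e_j'$) satisfying $$\Big(\frac{\tilde{\tilde p}_i}{\tilde p_i}\Big)'(v_i)\neq 0\qquad\text{for all } v_i\in\mathbb R .$$ Let $(h,G')$ be any candidate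 solution: $G'$ is a DAG on $[n]$ and $h:\mathcal X\to\mathbb R^n$ is a bijection whose inverse $h^{-1}:\mathbb R^n\to\mathbb R^d$ is a mixing function (so with image $\mathcal X$), such that there is a faithful causal model over $G'$ for which each $Q^e_Z=h_*(P^e_X)$ is the distribution resulting from a perfect single-node intervention, with the same target for the two environments of each pair (the targets may differ from those in the ground truth), and with density $q^e$ continuously differentiable and positive on $\mathbb R^n$. Then $(f^{-1},G)\sim_{\mathrm{CRL}}(h,G')$ (equivalently, $(h,G')\sim_{\mathrm{CRL}}(f^{-1},G)$): the latent variables are identified up to a permutation and element-wise reparametrisation, and the permutation is a graph isomorphism $G\to G'$. -/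

import Mathlib

open MeasureTheory ProbabilityTheory

/-- A directed acyclic graph on the vertex set `{0, …, n-1}`. -/
structure DAG (n : ℕ) where
  /-- the directed graph; `graph.Adj i j` means that there is an edge `i → j` -/
  graph : Digraph (Fin n)
  acyclic : ∀ i, ¬ Relation.TransGen graph.Adj i i

namespace DAG

/-- The parents of a node. -/
def parents {n : ℕ} (G : DAG n) (i : Fin n) : Set (Fin n) :=
  {j | G.graph.Adj j i}

/-- The non-descendants of a node (the node itself excluded). -/
def nonDescendants {n : ℕ} (G : DAG n) (i : Fin n) : Set (Fin n) :=
  {j | j ≠ i ∧ ¬ Relation.TransGen G.graph.Adj i j}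

/-- Every nonempty set of nodes contains a node without a child in that set. -/
theorem exists_sink {n : ℕ} (G : DAG n) (t : Finset (Fin n)) (ht : t.Nonempty) :
    ∃ i ∈ t, ∀ j ∈ t, ¬ G.graph.Adj i j := by
  have : IsTrans (Fin n) (fun a b => Relation.TransGen G.graph.Adj b a) :=
    ⟨fun _ _ _ h₁ h₂ => h₂.trans h₁⟩
  have : Std.Irrefl (fun a b : Fin n => Relation.TransGen G.graph.Adj b a) :=
    ⟨fun a => G.acyclic a⟩
  have wf : WellFounded (fun a b : Fin n => Relation.TransGen G.graph.Adj b a) :=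
    Finite.wellFounded_of_trans_of_irrefl _
  obtain ⟨i, hi, hmin⟩ := wf.has_min (t : Set (Fin n)) ht
  exact ⟨i, hi, fun j hj hij => hmin j hj (Relation.TransGen.single hij)⟩

end DAG

/-- `p x a` is a conditional probability density (with respect to Lebesgue measure) of a
real variable with value `x`, given that another variable has the value `a`. -/
structure IsCondDensity {α : Type*} [MeasurableSpace α] (p : ℝ → α → ℝ) : Prop where
  measurable : Measurable fun z : ℝ × α => p z.1 z.2
  nonneg : ∀ x a, 0 ≤ p x a
  lintegral_eq_one : ∀ a, ∫⁻ x, ENNReal.ofReal (p x a) = 1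

/-- `p` is a probability density on the real line. -/
structure IsDensity (p : ℝ → ℝ) : Prop where
  measurable : Measurable p
  nonneg : ∀ x, 0 ≤ p x
  lintegral_eq_one : ∫⁻ x, ENNReal.ofReal (p x) = 1

/-- The group `v_A` of the coordinates of `v` with index in `A`. -/
def coords {n : ℕ} (A : Set (Fin n)) (v : Fin n → ℝ) : A → ℝ :=
  fun i => v i

theorem measurable_coords {n : ℕ} (A : Set (Fin n)) : Measurable (coords A) :=
  measurable_pi_lambda _ fun i => measurable_pi_apply (i : Fin n)

/-- A causal model with graph `G`: for every node `i` a causal mechanism, that is, a conditional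
density `pᵢ(vᵢ | v_pa(i))` of the `i`-th variable given its parents. -/
structure CausalModel {n : ℕ} (G : DAG n) where
  mech : ∀ i : Fin n, ℝ → (G.parents i → ℝ) → ℝ
  isCondDensity : ∀ i, IsCondDensity (mech i)

/-- A perfect stochastic intervention: a set of targets, and for each target `i` a density
`p̃ᵢ(vᵢ)` which replaces the mechanism of `i`. The values of `mech` at the other nodes play
no role. -/
structure PerfectIntervention (n : ℕ) where
  targets : Finset (Fin n)
  mech : Fin n → ℝ → ℝ
  isDensity : ∀ i, IsDensity (mech i)

namespace CausalModel

variable {n : ℕ} {G : DAG n}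

/-- The joint density `p(v) = ∏ᵢ pᵢ(vᵢ | v_pa(i))`. -/
noncomputable def density (M : CausalModel G) (v : Fin n → ℝ) : ℝ :=
  ∏ i, M.mech i (v i) (coords (G.parents i) v)

/-- The joint distribution of the causal variables. -/
noncomputable def law (M : CausalModel G) : Measure (Fin n → ℝ) :=
  volume.withDensity fun v => ENNReal.ofReal (M.density v)

/-- The interventional model: the mechanisms of the targets are replaced, all others are kept. -/
noncomputable def intervene (M : CausalModel G) (I : PerfectIntervention n) : CausalModel G where
  mech i := if i ∈ I.targets then fun x _ => I.mech i x else M.mech i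
  isCondDensity i := by
    split_ifs
    · exact ⟨(I.isDensity i).measurable.comp measurable_fst, fun x _ => (I.isDensity i).nonneg x,
        fun _ => (I.isDensity i).lintegral_eq_one⟩
    · exact M.isCondDensity i

theorem measurable_mech (M : CausalModel G) (i : Fin n) :
    Measurable fun v : Fin n → ℝ => M.mech i (v i) (coords (G.parents i) v) :=
  (M.isCondDensity i).measurable.comp
    ((measurable_pi_apply i).prodMk (measurable_coords (G.parents i)))

/-- Integrating out the variables in `t` from the product of their mechanisms gives `1`. -/
theorem lmarginal_prod_mech (M : CausalModel G) (t : Finset (Fin n)) (v : Fin n → ℝ) :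
    (∫⋯∫⁻_t, (fun w => ∏ i ∈ t, ENNReal.ofReal (M.mech i (w i) (coords (G.parents i) w)))
      ∂(fun _ => (volume : Measure ℝ))) v = 1 := by
  induction t using Finset.strongInduction generalizing v with
  | H t ih =>
    rcases t.eq_empty_or_nonempty with rfl | ht
    · simp
    obtain ⟨i, hi, hsink⟩ := G.exists_sink t ht
    have hmeas : ∀ s : Finset (Fin n), Measurable fun w : Fin n → ℝ =>
        ∏ k ∈ s, ENNReal.ofReal (M.mech k (w k) (coords (G.parents k) w)) := fun s =>
      Finset.measurable_prod _ fun k _ => (M.measurable_mech k).ennreal_ofReal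
    rw [lmarginal_erase' _ (hmeas t) hi, ← ih (t.erase i) (Finset.erase_ssubset hi) v]
    congr 1
    funext w
    have hrest : ∀ x : ℝ, ∀ k ∈ t.erase i,
        ENNReal.ofReal (M.mech k (Function.update w i x k) (coords (G.parents k) (Function.update w i x)))
          = ENNReal.ofReal (M.mech k (w k) (coords (G.parents k) w)) := by
      intro x k hk
      have hki := Finset.ne_of_mem_erase hk
      have hpa : coords (G.parents k) (Function.update w i x) = coords (G.parents k) w := by
        funext j
        refine Function.update_of_ne ?_ _ _
        intro hji
        exact hsink k (Finset.mem_of_mem_erase hk) (hji ▸ j.2)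
      rw [Function.update_of_ne hki, hpa]
    have hself : ∀ x : ℝ, coords (G.parents i) (Function.update w i x) = coords (G.parents i) w := by
      intro x
      funext j
      refine Function.update_of_ne ?_ _ _
      intro hji
      exact hsink i hi (show G.graph.Adj i i from (by simpa [hji] using j.2 : i ∈ G.parents i))
    have hfun : ∀ x : ℝ, (∏ k ∈ t, ENNReal.ofReal
        (M.mech k (Function.update w i x k) (coords (G.parents k) (Function.update w i x))))
        = ENNReal.ofReal (M.mech i x (coords (G.parents i) w))
          * ∏ k ∈ t.erase i, ENNReal.ofReal (M.mech k (w k) (coords (G.parents k) w)) := by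
      intro x
      rw [← Finset.mul_prod_erase t _ hi, Finset.prod_congr rfl (hrest x), hself x,
        Function.update_self]
    simp_rw [hfun]
    rw [lintegral_mul_const, (M.isCondDensity i).lintegral_eq_one, one_mul]
    exact ((M.isCondDensity i).measurable.comp
      (measurable_id.prodMk measurable_const)).ennreal_ofReal

instance isProbabilityMeasure_law (M : CausalModel G) : IsProbabilityMeasure M.law := by
  constructor
  rw [law, withDensity_apply _ MeasurableSet.univ, Measure.restrict_univ]
  have h := M.lmarginal_prod_mech Finset.univ 0
  rw [lmarginal_univ] at h
  rw [← h, volume_pi]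
  refine lintegral_congr fun v => ?_
  rw [density, ENNReal.ofReal_prod_of_nonneg fun i _ => (M.isCondDensity i).nonneg _ _]

/-- The joint density is continuously differentiable and positive on all of `ℝⁿ`. -/
def IsRegular (M : CausalModel G) : Prop :=
  ContDiff ℝ 1 M.density ∧ ∀ v, 0 < M.density v

end CausalModel

/-- Conditional independence `V_A ⫫ V_B | V_C` of groups of coordinates under the law `μ`. -/
def CondIndepCoords {n : ℕ} (μ : Measure (Fin n → ℝ)) [IsFiniteMeasure μ]
    (A B C : Set (Fin n)) : Prop :=
  CondIndepFun (MeasurableSpace.comap (coords C) inferInstance) (measurable_coords C).comap_le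
    (coords A) (coords B) μ

/-- The causal Markov condition: every variable is independent of its non-descendants given its
parents. -/
def IsMarkov {n : ℕ} (G : DAG n) (μ : Measure (Fin n → ℝ)) [IsFiniteMeasure μ] : Prop :=
  ∀ i, CondIndepCoords μ {i} (G.nonDescendants i) (G.parents i)

/-- Faithfulness: the only conditional independences (between disjoint groups of variables) that
hold under `μ` are those implied by the causal Markov condition, i.e. those which hold under every
distribution on `ℝⁿ` satisfying it. -/
def IsFaithful {n : ℕ} (G : DAG n) (μ : Measure (Fin n → ℝ)) [IsFiniteMeasure μ] : Prop :=
  ∀ A B C : Set (Fin n), Disjoint A B → Disjoint A C → Disjoint B C →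
    CondIndepCoords μ A B C →
      ∀ (ν : Measure (Fin n → ℝ)) [IsProbabilityMeasure ν], IsMarkov G ν →
        CondIndepCoords ν A B C

/-- `f : ℝⁿ → ℝᵈ` is a diffeomorphism (of class `C¹`) onto its image, with inverse `g`. Only the
values of `g` on the image of `f` matter. -/
structure IsDiffeoOntoImage {n d : ℕ} (f : (Fin n → ℝ) → (Fin d → ℝ))
    (g : (Fin d → ℝ) → (Fin n → ℝ)) : Prop where
  contDiff : ContDiff ℝ 1 f
  leftInverse : Function.LeftInverse g f
  contDiffOn_inverse : ContDiffOn ℝ 1 g (Set.range f)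

/-- The relation `(h₁, G₁) ∼ (h₂, G₂)` for unmixing functions on `X ⊆ ℝᵈ` and DAGs:
`h₂ = P_{π⁻¹} ∘ φ ∘ h₁` on `X` for an element-wise diffeomorphism `φ` and a permutation `π` which
is a graph isomorphism from `G₁` to `G₂`. -/
def CRLEquiv {n d : ℕ} (X : Set (Fin d → ℝ)) (a b : ((Fin d → ℝ) → (Fin n → ℝ)) × DAG n) : Prop :=
  ∃ (φ : Fin n → ℝ ≃ ℝ) (π : Equiv.Perm (Fin n)),
    (∀ i, ContDiff ℝ 1 (φ i) ∧ ContDiff ℝ 1 (φ i).symm) ∧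
    (∀ i j, a.2.graph.Adj i j ↔ b.2.graph.Adj (π i) (π j)) ∧
    ∀ x ∈ X, ∀ k, b.1 x k = φ (π.symm k) (a.1 x (π.symm k))

theorem CRLEquiv.equivalence {n d : ℕ} (X : Set (Fin d → ℝ)) :
    Equivalence (CRLEquiv (n := n) X) := by
  refine ⟨fun a => ⟨fun _ => Equiv.refl ℝ, Equiv.refl _, fun _ => ⟨contDiff_id, contDiff_id⟩,
    fun _ _ => Iff.rfl, fun _ _ _ => rfl⟩, ?_, ?_⟩
  · rintro a b ⟨φ, π, hφ, hG, h⟩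
    refine ⟨fun k => (φ (π.symm k)).symm, π.symm, fun k => ⟨(hφ _).2, (hφ _).1⟩,
      fun i j => by simp [hG], fun x hx k => ?_⟩
    simp [h x hx]
  · rintro a b c ⟨φ, π, hφ, hG, h⟩ ⟨φ', π', hφ', hG', h'⟩
    refine ⟨fun i => (φ i).trans (φ' (π i)), π.trans π',
      fun i => ⟨(hφ' _).1.comp (hφ _).1, (hφ _).2.comp (hφ' _).2⟩,
      fun i j => by simp [hG, hG'], fun x hx k => ?_⟩
    simp [h x hx, h' x hx]

/-! The transition map `ψ = h ∘ f` is a `C¹` diffeomorphism of `ℝⁿ` that carries each latent law of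
the ground truth to that of the candidate, so `p^e(v) = |det Dψ(v)| q^e(ψ v)` everywhere
(`density_eq_abs_det_mul`). In the quotient over a pair of environments the Jacobian and all
mechanisms that are not intervened on cancel, leaving `r(vᵢ) = r'(ψ(v)ₖ)`, where `i` and `k` are the
two targets. Since `deriv r` never vanishes, the chain rule makes `ψ(v)ₖ` a function of `vᵢ` alone
(`eq_of_comp_eq`) and `i ↦ k` injective. Hence `ψ` is element-wise up to a permutation `π`.

For the graphs, pull the candidate model back along `ψ` to a model on the relabelled graph. Its
single-node interventional densities agree with those of the ground truth. Integrating out all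
variables but the target shows that the intervened mechanisms agree; dividing by them leaves the
products of all mechanisms but one, and for `n ≥ 2` these determine each mechanism
(`mechAt_eq_of_forall_mul_prod_eq`). Faithfulness makes every mechanism depend on every parent
(`isMinimal_of_isFaithful`): otherwise child and parent would be independent given the other
parents, which the Markov condition does not imply. So the mechanisms determine the edges. -/

/-! ### Criteria for conditional independence -/

section CondIndep

variable {Ω β β' : Type*} {m' mΩ : MeasurableSpace Ω} [StandardBorelSpace Ω]
  {mβ : MeasurableSpace β} {mβ' : MeasurableSpace β'} {hm' : m' ≤ mΩ}
  {μ : Measure Ω} [IsFiniteMeasure μ]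

theorem condIndepFun_congr_left {X X' : Ω → β} {Y : Ω → β'} (hX : Measurable X)
    (hX' : Measurable X') (hY : Measurable Y) (hXX' : X =ᵐ[μ] X')
    (h : CondIndepFun m' hm' X' Y μ) : CondIndepFun m' hm' X Y μ := by
  rw [condIndepFun_iff_condExp_inter_preimage_eq_mul hX hY]
  rw [condIndepFun_iff_condExp_inter_preimage_eq_mul hX' hY] at h
  intro s t hs ht
  have hset : X ⁻¹' s =ᵐ[μ] X' ⁻¹' s := hXX'.preimage s
  have h₁ : (X ⁻¹' s ∩ Y ⁻¹' t).indicator (fun _ => (1 : ℝ))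
      =ᵐ[μ] (X' ⁻¹' s ∩ Y ⁻¹' t).indicator (fun _ => (1 : ℝ)) :=
    indicator_ae_eq_of_ae_eq_set (hset.inter (ae_eq_refl _))
  have h₂ : (X ⁻¹' s).indicator (fun _ => (1 : ℝ))
      =ᵐ[μ] (X' ⁻¹' s).indicator (fun _ => (1 : ℝ)) :=
    indicator_ae_eq_of_ae_eq_set hset
  filter_upwards [h s t hs ht, condExp_congr_ae (m := m') h₁, condExp_congr_ae (m := m') h₂]
    with ω e₀ e₁ e₂
  rw [e₁, e₂, e₀]

/-- A variable which is almost surely equal to a conditioning-measurable one is conditionally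
independent of everything. -/
theorem condIndepFun_of_ae_eq_measurable_left {X X' : Ω → β} {Y : Ω → β'} (hX : Measurable X)
    (hX' : Measurable[m'] X') (hY : Measurable Y) (hXX' : X =ᵐ[μ] X') :
    CondIndepFun m' hm' X Y μ :=
  condIndepFun_congr_left hX (hX'.mono hm' le_rfl) hY hXX' (condIndepFun_of_measurable_left hX' hY)

/-- If the conditional probability of `X ∈ s` given `m'` and `Y` is `m'`-measurable, then `X` and
`Y` are conditionally independent given `m'`. -/
theorem condIndepFun_of_measure_inter_eq_setLIntegral {X : Ω → β} {Y : Ω → β'}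
    (hX : Measurable X) (hY : Measurable Y) (K : Set β → Ω → ENNReal)
    (hK : ∀ s, MeasurableSet s → Measurable[m'] (K s)) (hK1 : ∀ s ω, K s ω ≤ 1)
    (h : ∀ s t D, MeasurableSet s → MeasurableSet t → MeasurableSet[m'] D →
      μ (X ⁻¹' s ∩ (D ∩ Y ⁻¹' t)) = ∫⁻ ω in D ∩ Y ⁻¹' t, K s ω ∂μ) :
    CondIndepFun m' hm' X Y μ := by
  rw [condIndepFun_iff_condExp_inter_preimage_eq_mul hX hY]
  intro s t hs ht
  let κ : Ω → ℝ := fun ω => (K s ω).toReal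
  have hκm : Measurable[m'] κ := (hK s hs).ennreal_toReal
  have hκ : Measurable κ := hκm.mono hm' le_rfl
  have hκb : ∀ ω, ‖κ ω‖ ≤ 1 := fun ω => by
    rw [Real.norm_of_nonneg ENNReal.toReal_nonneg]
    exact ENNReal.toReal_mono ENNReal.one_ne_top (hK1 s ω)
  have hκi : Integrable κ μ := .of_bound hκ.aestronglyMeasurable 1 (ae_of_all _ hκb)
  have hind : ∀ A : Set Ω, MeasurableSet A → Integrable (A.indicator fun _ => (1 : ℝ)) μ :=
    fun A hA => (integrable_const 1).indicator hA
  have hint : ∀ t D, MeasurableSet t → MeasurableSet[m'] D →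
      ∫ ω in D ∩ Y ⁻¹' t, κ ω ∂μ = μ.real (X ⁻¹' s ∩ (D ∩ Y ⁻¹' t)) := by
    intro t D ht hD
    rw [integral_toReal ((hK s hs).mono hm' le_rfl).aemeasurable
      (ae_of_all _ fun ω => (hK1 s ω).trans_lt ENNReal.one_lt_top), ← h s t D hs ht hD,
      Measure.real]
  -- Taking `t = univ` identifies `κ` as the conditional probability of `X ∈ s`. For general `t`,
  -- `e₂` computes the joint probability as the conditional expectation of `κ` times an indicator,
  -- and `e₃` pulls `κ` out.
  have e₁ : κ =ᵐ[μ] μ⟦X ⁻¹' s | m'⟧ := by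
    refine ae_eq_condExp_of_forall_setIntegral_eq hm' (hind _ (hX hs))
      (fun _ _ _ => hκi.integrableOn) (fun D hD _ => ?_) hκm.aestronglyMeasurable
    have := hint Set.univ D .univ hD
    rw [Set.preimage_univ, Set.inter_univ] at this
    rw [this, setIntegral_indicator (hX hs), setIntegral_const, smul_eq_mul, mul_one,
      Set.inter_comm]
  have hprod : κ * (Y ⁻¹' t).indicator (fun _ => (1 : ℝ)) = (Y ⁻¹' t).indicator κ := by
    ext ω
    by_cases hω : ω ∈ Y ⁻¹' t <;> simp [hω]
  have e₂ : μ[κ * (Y ⁻¹' t).indicator (fun _ => (1 : ℝ)) | m']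
      =ᵐ[μ] μ⟦X ⁻¹' s ∩ Y ⁻¹' t | m'⟧ := by
    refine ae_eq_condExp_of_forall_setIntegral_eq hm' (hind _ ((hX hs).inter (hY ht)))
      (fun _ _ _ => integrable_condExp.integrableOn) (fun D hD _ => ?_)
      stronglyMeasurable_condExp.aestronglyMeasurable
    rw [hprod, setIntegral_condExp hm' (hκi.indicator (hY ht)) hD, setIntegral_indicator (hY ht),
      hint t D ht hD, setIntegral_indicator ((hX hs).inter (hY ht)), setIntegral_const,
      smul_eq_mul, mul_one, Set.inter_left_comm]
  have e₃ := condExp_stronglyMeasurable_mul_of_bound hm' hκm.stronglyMeasurable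
    (hind _ (hY ht)) 1 (ae_of_all _ hκb)
  filter_upwards [e₁, e₂, e₃] with ω h₁ h₂ h₃
  rw [← h₂, h₃, ← h₁]
  rfl

end CondIndep

/-! ### Mechanisms as conditional probabilities -/

theorem lmarginal_mul_left_of_forall_eq {δ : Type*} {X : δ → Type*} [DecidableEq δ]
    [∀ i, MeasurableSpace (X i)] (μ : ∀ i, Measure (X i)) (s : Finset δ)
    {F g : (∀ i, X i) → ENNReal} (hg : Measurable g)
    (hF : ∀ v w, (∀ i ∉ s, v i = w i) → F v = F w) :
    (∫⋯∫⁻_s, (fun v => F v * g v) ∂μ) = fun v => F v * (∫⋯∫⁻_s, g ∂μ) v := by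
  funext v
  simp only [lmarginal]
  rw [← lintegral_const_mul (F v) (f := fun y => g (Function.updateFinset v s y))
    (hg.comp measurable_updateFinset)]
  refine lintegral_congr fun y => ?_
  rw [hF (Function.updateFinset v s y) v fun i hi => by simp [Function.updateFinset, hi]]

namespace CausalModel

variable {n : ℕ} {G : DAG n}

/-- The mechanism of node `i` as an extended nonnegative function of all variables. -/
noncomputable def emech (M : CausalModel G) (i : Fin n) (v : Fin n → ℝ) : ENNReal :=
  ENNReal.ofReal (M.mech i (v i) (coords (G.parents i) v))

theorem measurable_emech (M : CausalModel G) (i : Fin n) : Measurable (M.emech i) :=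
  (M.measurable_mech i).ennreal_ofReal

theorem measurable_prod_emech (M : CausalModel G) (s : Finset (Fin n)) :
    Measurable fun v => ∏ i ∈ s, M.emech i v :=
  Finset.measurable_prod _ fun i _ => M.measurable_emech i

theorem emech_congr (M : CausalModel G) {i : Fin n} {v w : Fin n → ℝ} (hi : v i = w i)
    (hpa : ∀ j ∈ G.parents i, v j = w j) : M.emech i v = M.emech i w := by
  have : coords (G.parents i) v = coords (G.parents i) w := funext fun j => hpa j j.2
  rw [emech, emech, hi, this]

theorem ofReal_density (M : CausalModel G) (v : Fin n → ℝ) :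
    ENNReal.ofReal (M.density v) = ∏ i, M.emech i v :=
  ENNReal.ofReal_prod_of_nonneg fun i _ => (M.isCondDensity i).nonneg _ _

theorem measurable_density (M : CausalModel G) : Measurable M.density :=
  Finset.measurable_prod _ fun i _ => M.measurable_mech i

/-- A set of nodes which contains all children of its elements can be integrated out. -/
theorem lintegral_law_eq_lmarginal (M : CausalModel G) (T : Finset (Fin n))
    (hT : ∀ i ∈ T, ∀ j, G.graph.Adj i j → j ∈ T) {F : (Fin n → ℝ) → ENNReal}
    (hFm : Measurable F) (hF : ∀ v w, (∀ i ∉ T, v i = w i) → F v = F w) :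
    ∫⁻ v, F v ∂M.law
      = (∫⋯∫⁻_Tᶜ, (fun v => F v * ∏ i ∈ Tᶜ, M.emech i v) ∂fun _ => (volume : Measure ℝ)) 0 := by
  have hm := M.measurable_prod_emech
  rw [law, lintegral_withDensity_eq_lintegral_mul _ M.measurable_density.ennreal_ofReal hFm,
    volume_pi, lintegral_eq_lmarginal_univ 0, show (Finset.univ : Finset (Fin n)) = Tᶜ ∪ T by
      rw [Finset.union_comm, Finset.union_compl],
    lmarginal_union _ _ (M.measurable_density.ennreal_ofReal.mul hFm) disjoint_compl_left]
  congr 1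
  have hsplit : (fun v => ENNReal.ofReal (M.density v)) * F
      = fun v => (F v * ∏ i ∈ Tᶜ, M.emech i v) * ∏ i ∈ T, M.emech i v := by
    funext v
    rw [Pi.mul_apply, ofReal_density, ← Finset.prod_mul_prod_compl T]
    ring
  -- As `T` is closed under children, mechanisms outside `T` do not see the variables in `T`; those
  -- inside integrate to `1`.
  rw [hsplit, lmarginal_mul_left_of_forall_eq _ _ (hm T)]
  · funext v
    rw [show (fun v => ∏ i ∈ T, M.emech i v) = fun w => ∏ i ∈ T,
      ENNReal.ofReal (M.mech i (w i) (coords (G.parents i) w)) from rfl, M.lmarginal_prod_mech T v,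
      mul_one]
  · intro v w hvw
    rw [hF v w hvw]
    congr 1
    refine Finset.prod_congr rfl fun i hi => M.emech_congr (hvw i (Finset.mem_compl.1 hi)) ?_
    exact fun j hj => hvw j fun hjT => Finset.mem_compl.1 hi (hT j hjT i hj)

/-- The mechanism of `j` gives the conditional probability of `v j ∈ s` given any event that
concerns the non-descendants of `j` only. -/
theorem law_inter_eq_setLIntegral (M : CausalModel G) (j : Fin n) {s : Set ℝ}
    (hs : MeasurableSet s) {E : Set (Fin n → ℝ)} (hE : MeasurableSet E)
    (hEd : ∀ v w, (∀ i, ¬ Relation.ReflTransGen G.graph.Adj j i → v i = w i) →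
      (v ∈ E ↔ w ∈ E)) :
    M.law ((fun v => v j) ⁻¹' s ∩ E)
      = ∫⁻ v in E, (∫⁻ x in s, ENNReal.ofReal (M.mech j x (coords (G.parents j) v))) ∂M.law := by
  classical
  -- `S` consists of `j` and its descendants, and `T` omits `j`; both are closed under children.
  -- Integrating out `T` on the left and `S` on the right leaves expressions that differ only by the
  -- integral over `v j`.
  let S : Finset (Fin n) := {i | Relation.ReflTransGen G.graph.Adj j i}
  let T : Finset (Fin n) := S.erase j
  have hjS : j ∈ S := by simp [S, Relation.ReflTransGen.refl]
  have hself : ∀ i ∈ S, ¬ G.graph.Adj i j := fun i hi hij =>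
    G.acyclic j (Relation.TransGen.tail' (by simpa [S] using hi) hij)
  have hS : ∀ i ∈ S, ∀ k, G.graph.Adj i k → k ∈ S := fun i hi k hik => by
    simp only [S, Finset.mem_filter, Finset.mem_univ, true_and] at hi ⊢
    exact hi.tail hik
  have hT : ∀ i ∈ T, ∀ k, G.graph.Adj i k → k ∈ T := fun i hi k hik =>
    Finset.mem_erase.2 ⟨fun hk => hself i (Finset.mem_of_mem_erase hi) (hk ▸ hik),
      hS i (Finset.mem_of_mem_erase hi) k hik⟩
  have hTc : Tᶜ = insert j Sᶜ := by
    ext i; by_cases hi : i = j <;> simp [T, hi]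
  let κ : (Fin n → ℝ) → ENNReal := fun v =>
    ∫⁻ x in s, ENNReal.ofReal (M.mech j x (coords (G.parents j) v))
  have hκ : Measurable κ :=
    Measurable.lintegral_prod_right' (f := fun z : (Fin n → ℝ) × ℝ =>
        ENNReal.ofReal (M.mech j z.2 (coords (G.parents j) z.1)))
      ((M.isCondDensity j).measurable.comp
        (measurable_snd.prodMk ((measurable_coords _).comp measurable_fst))).ennreal_ofReal
  have hjs : MeasurableSet ((fun v : Fin n → ℝ => v j) ⁻¹' s) := measurable_pi_apply j hs
  have hES : ∀ v w : Fin n → ℝ, (∀ i ∉ S, v i = w i) → (v ∈ E ↔ w ∈ E) := fun v w hvw =>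
    hEd v w fun i hi => hvw i (by simpa [S] using hi)
  rw [← lintegral_indicator_one (hjs.inter hE), ← lintegral_indicator hE,
    M.lintegral_law_eq_lmarginal T hT (measurable_one.indicator (hjs.inter hE)),
    M.lintegral_law_eq_lmarginal S hS (hκ.indicator hE), hTc,
    lmarginal_insert' _ _ (by simpa using hjS)]
  · congr 2
    funext v
    have hup : ∀ x, ∀ i ∉ S, Function.update v j x i = v i := fun x i hi =>
      Function.update_of_ne (ne_of_mem_of_not_mem hjS hi).symm _ _
    have hpa : ∀ x, coords (G.parents j) (Function.update v j x) = coords (G.parents j) v :=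
      fun x => funext fun i => hup x i fun hi => hself i hi i.2
    have hprod : ∀ x, ∏ i ∈ Sᶜ, M.emech i (Function.update v j x) = ∏ i ∈ Sᶜ, M.emech i v :=
      fun x => Finset.prod_congr rfl fun i hi =>
        M.emech_congr (hup x i (Finset.mem_compl.1 hi)) fun k hk => hup x k fun hkS =>
          Finset.mem_compl.1 hi (hS k hkS i hk)
    simp only [Finset.prod_insert (show j ∉ Sᶜ by simpa using hjS), hprod]
    have hmem : ∀ x, (Function.update v j x ∈ E ↔ v ∈ E) := fun x => hES _ _ (hup x)
    by_cases hv : v ∈ E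
    · rw [Set.indicator_of_mem hv]
      simp only [κ]
      rw [← lintegral_indicator hs, ← lintegral_mul_const]
      · refine lintegral_congr fun x => ?_
        by_cases hx : x ∈ s <;> simp [hx, hmem, hv, emech, hpa, Set.indicator]
      · exact Measurable.indicator ((M.isCondDensity j).measurable.comp
          (measurable_id.prodMk measurable_const)).ennreal_ofReal hs
    · simp [hmem, hv, Set.indicator]
  · exact (measurable_one.indicator (hjs.inter hE)).mul (M.measurable_prod_emech _)
  · intro v w hvw
    have h₁ := hES v w hvw
    have h₂ : κ v = κ w := by
      have : coords (G.parents j) v = coords (G.parents j) w :=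
        funext fun i => hvw i fun hi => hself i hi i.2
      simp only [κ, this]
    simp only [Set.indicator, h₁, κ] at h₂ ⊢
    rw [h₂]
  · intro v w hvw
    have h₁ := hES v w fun i hi => hvw i fun h => hi (Finset.mem_of_mem_erase h)
    have h₂ := hvw j (by simp [T])
    simp only [Set.indicator, Set.mem_inter_iff, Set.mem_preimage, h₁, h₂, Pi.one_apply]

end CausalModel

/-! ### Faithfulness forces dependence on every parent -/

namespace CausalModel

variable {n : ℕ} {G : DAG n}

/-- If the mechanism of `j` does not depend on the parent `i`, then the `j`-th and the `i`-th
variable are conditionally independent given the remaining parents of `j`. -/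
theorem condIndepCoords_law_of_mech_eq (M : CausalModel G) {i j : Fin n}
    (hij : G.graph.Adj i j)
    (hmech : ∀ x v w, (∀ k ∈ G.parents j \ {i}, v k = w k) →
      M.mech j x (coords (G.parents j) v) = M.mech j x (coords (G.parents j) w)) :
    CondIndepCoords M.law {j} {i} (G.parents j \ {i}) := by
  classical
  let C := G.parents j \ {i}
  -- Padding by `0` is harmless: by `hmech` the mechanism reads only the parents in `C`, so `K s`
  -- factors through `coords C`.
  let ext : (C → ℝ) → Fin n → ℝ := fun c k => if h : k ∈ C then c ⟨k, h⟩ else 0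
  have hext : Measurable ext := by
    refine measurable_pi_lambda _ fun k => ?_
    by_cases h : k ∈ C
    · simpa [ext, h] using measurable_pi_apply (⟨k, h⟩ : C)
    · simp [ext, h]
  let single : ℝ → ({j} : Set (Fin n)) → ℝ := fun x _ => x
  have hsingle : Measurable single := measurable_pi_lambda _ fun _ => measurable_id
  have hpre : ∀ s, coords {j} ⁻¹' s = (fun v : Fin n → ℝ => v j) ⁻¹' (single ⁻¹' s) := by
    intro s
    ext v
    have : coords {j} v = single (v j) := by
      funext ⟨k, hk⟩
      rw [Set.mem_singleton_iff] at hk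
      simp [coords, single, hk]
    simp [this]
  let K : Set (({j} : Set (Fin n)) → ℝ) → (Fin n → ℝ) → ENNReal := fun s v =>
    ∫⁻ x in single ⁻¹' s, ENNReal.ofReal (M.mech j x (coords (G.parents j) v))
  refine condIndepFun_of_measure_inter_eq_setLIntegral (measurable_coords _) (measurable_coords _)
    K ?_ ?_ ?_
  · intro s hs
    have hfac : K s = (fun c => K s (ext c)) ∘ coords C := by
      funext v
      refine lintegral_congr fun x => ?_
      rw [hmech x v (ext (coords C v)) fun k hk => by
        rw [show ext (coords C v) k = v k by simp only [ext, dif_pos (show k ∈ C from hk)]; rfl]]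
    have hK : Measurable fun c => K s (ext c) :=
      Measurable.lintegral_prod_right' (f := fun z : (C → ℝ) × ℝ =>
          ENNReal.ofReal (M.mech j z.2 (coords (G.parents j) (ext z.1))))
        ((M.isCondDensity j).measurable.comp (measurable_snd.prodMk
          ((measurable_coords _).comp (hext.comp measurable_fst)))).ennreal_ofReal
    rw [hfac]
    exact hK.comp (comap_measurable (coords C))
  · exact fun s v => (setLIntegral_le_lintegral _ _).trans
      ((M.isCondDensity j).lintegral_eq_one _).le
  · rintro s t _ hs ht ⟨D, hD, rfl⟩
    rw [hpre]
    refine M.law_inter_eq_setLIntegral j (hsingle hs)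
      ((measurable_coords _ hD).inter (measurable_coords _ ht)) fun v w hvw => ?_
    have hpa : ∀ k ∈ G.parents j, v k = w k := fun k hk =>
      hvw k fun h => G.acyclic j (Relation.TransGen.tail' h hk)
    have h₁ : coords (G.parents j \ {i}) v = coords (G.parents j \ {i}) w :=
      funext fun k => hpa k k.2.1
    have h₂ : coords {i} v = coords {i} w := funext fun k => hpa k (by
      have hk : (k : Fin n) = i := k.2
      rw [hk]; exact hij)
    simp [h₁, h₂]

end CausalModel

/-- For every edge `i → j` there is a Markov distribution under which `j` and `i` are dependent
given the other parents of `j`: the `i`-th and `j`-th variable are one and the same fair coin, all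
others vanish. -/
theorem exists_isMarkov_not_condIndepCoords {n : ℕ} (G : DAG n) {i j : Fin n}
    (hij : G.graph.Adj i j) :
    ∃ (ν : Measure (Fin n → ℝ)) (_ : IsProbabilityMeasure ν), IsMarkov G ν ∧
      ¬ CondIndepCoords ν {j} {i} (G.parents j \ {i}) := by
  classical
  let u : Fin n → ℝ := fun k => if k = i ∨ k = j then 1 else 0
  let ν : Measure (Fin n → ℝ) :=
    (2⁻¹ : ENNReal) • Measure.dirac 0 + (2⁻¹ : ENNReal) • Measure.dirac u
  have hprob : IsProbabilityMeasure ν := ⟨by simp [ν, ENNReal.inv_two_add_inv_two]⟩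
  have hae : ∀ p : (Fin n → ℝ) → Prop, (∀ᵐ v ∂ν, p v) ↔ p 0 ∧ p u := by
    intro p
    simp only [ν, ae_add_measure_iff]
    rw [Measure.ae_ennreal_smul_measure_iff (by simp), Measure.ae_ennreal_smul_measure_iff (by simp),
      ae_dirac_eq, ae_dirac_eq]
    simp
  refine ⟨ν, hprob, fun l => ?_, fun hci => ?_⟩
  -- Markov condition: `V_j` equals its parent `V_i` almost surely; the non-descendants of `i`
  -- exclude both `i` and `j`, hence vanish; every other variable vanishes itself.
  · by_cases hlj : l = j
    · subst hlj
      refine condIndepFun_of_ae_eq_measurable_left (X' := fun v _ => v i) (measurable_coords _) ?_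
        (measurable_coords _) ?_
      · have : Measurable fun (c : G.parents l → ℝ) (_ : ({l} : Set (Fin n))) => c ⟨i, hij⟩ :=
          measurable_pi_lambda _ fun _ => measurable_pi_apply _
        exact this.comp (comap_measurable (coords (G.parents l)))
      · refine (hae _).2 ⟨rfl, funext fun ⟨k, hk⟩ => ?_⟩
        rw [Set.mem_singleton_iff] at hk
        simp [coords, u, hk]
    by_cases hli : l = i
    · subst hli
      refine CondIndepFun.symm (condIndepFun_of_ae_eq_measurable_left (X' := fun _ _ => (0 : ℝ))
        (measurable_coords _) measurable_const (measurable_coords _) ?_)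
      refine (hae _).2 ⟨rfl, funext fun ⟨k, hk⟩ => ?_⟩
      have : k ≠ j := fun h => hk.2 (h ▸ Relation.TransGen.single hij)
      simp [coords, u, hk.1, this]
    · refine condIndepFun_of_ae_eq_measurable_left (X' := fun _ _ => (0 : ℝ))
        (measurable_coords _) measurable_const (measurable_coords _) ?_
      refine (hae _).2 ⟨rfl, funext fun ⟨k, hk⟩ => ?_⟩
      rw [Set.mem_singleton_iff] at hk
      simp [coords, u, hk, hlj, hli]
  · have hm := (measurable_coords (G.parents j \ {i})).comap_le
    rw [CondIndepCoords, condIndepFun_iff_condExp_inter_preimage_eq_mul (measurable_coords _)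
      (measurable_coords _)] at hci
    let s : ∀ k : Fin n, Set (({k} : Set (Fin n)) → ℝ) := fun k => {c | c ⟨k, rfl⟩ = 1}
    have hs : ∀ k, MeasurableSet (s k) := fun k =>
      measurable_pi_apply (⟨k, rfl⟩ : ({k} : Set (Fin n))) (measurableSet_singleton 1)
    let A : Set (Fin n → ℝ) := coords {j} ⁻¹' s j
    have hAm : MeasurableSet A := measurable_coords _ (hs j)
    have hνA : ∫ v, A.indicator (fun _ => (1 : ℝ)) v ∂ν = 2⁻¹ := by
      rw [integral_indicator hAm, setIntegral_const, smul_eq_mul, mul_one]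
      simp [Measure.real, ν, A, s, coords, u]
    have key := hci (s j) (s i) (hs j) (hs i)
    have hAi : (fun v : Fin n → ℝ => A.indicator (fun _ => (1 : ℝ)) v)
        =ᵐ[ν] (coords {i} ⁻¹' s i).indicator (fun _ => (1 : ℝ)) := by
      refine (hae _).2 ⟨?_, ?_⟩ <;> simp [A, s, coords, u, Set.indicator]
    have hAij : (A ∩ coords {i} ⁻¹' s i).indicator (fun _ => (1 : ℝ))
        =ᵐ[ν] A.indicator (fun _ => (1 : ℝ)) := by
      refine (hae _).2 ⟨?_, ?_⟩ <;> simp [A, s, coords, u, Set.indicator]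
    let m := MeasurableSpace.comap (coords (G.parents j \ {i})) inferInstance
    -- `g` is constant on the two atoms, because they agree off `i` and `j`. Independence together
    -- with `V_i = V_j` gives `g = g²`, whereas `g` has mean `1/2`.
    let g : (Fin n → ℝ) → ℝ := ν⟦A | m⟧
    have hg : Measurable[m] g := stronglyMeasurable_condExp.measurable
    have hg0 : g u = g 0 := by
      obtain ⟨D, -, hD⟩ := hg (measurableSet_singleton (g 0))
      have hcoords : coords (G.parents j \ {i}) u = coords (G.parents j \ {i}) 0 := by
        funext ⟨k, hk⟩
        have hki : k ≠ i := fun h => hk.2 h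
        have hkj : k ≠ j := fun h => G.acyclic j (Relation.TransGen.single (h ▸ hk.1))
        simp [coords, u, hki, hkj]
      have h0 : (0 : Fin n → ℝ) ∈ coords (G.parents j \ {i}) ⁻¹' D := by rw [hD]; rfl
      have hu : u ∈ coords (G.parents j \ {i}) ⁻¹' D := by
        rw [Set.mem_preimage, hcoords]; exact h0
      rw [hD] at hu
      exact hu
    have hsq : g 0 = g 0 * g 0 := by
      have h : ∀ᵐ v ∂ν, g v = g v * g v := by
        filter_upwards [key, condExp_congr_ae (m := m) hAi, condExp_congr_ae (m := m) hAij]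
          with v h₁ h₂ h₃
        change (ν⟦A | m⟧) v = (ν⟦A | m⟧) v * (ν⟦A | m⟧) v
        exact h₃.symm.trans (h₁.trans (congrArg _ h₂.symm))
      exact ((hae _).1 h).1
    have hint : ∫ v, g v ∂ν = 2⁻¹ := by
      rw [integral_condExp hm, hνA]
    have hconst : ∫ v, g v ∂ν = g 0 := by
      rw [integral_congr_ae (g := fun _ => g 0) ((hae _).2 ⟨rfl, hg0⟩)]
      simp
    rw [← hconst, hint] at hsq
    norm_num at hsq

/-- In a faithful causal model every mechanism depends on every parent. -/
theorem CausalModel.exists_mech_ne_of_isFaithful {n : ℕ} {G : DAG n} (M : CausalModel G)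
    (hM : IsFaithful G M.law) {i j : Fin n} (hij : G.graph.Adj i j) :
    ∃ (x : ℝ) (v w : Fin n → ℝ), (∀ k, k ≠ i → v k = w k) ∧
      M.mech j x (coords (G.parents j) v) ≠ M.mech j x (coords (G.parents j) w) := by
  by_contra! hcon
  have hne : i ≠ j := fun h => G.acyclic j (Relation.TransGen.single (h ▸ hij))
  obtain ⟨ν, hν, hmarkov, hnot⟩ := exists_isMarkov_not_condIndepCoords G hij
  refine hnot (hM {j} {i} (G.parents j \ {i}) ?_ ?_ ?_ ?_ ν hmarkov)
  · simpa using hne.symm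
  · rw [Set.disjoint_singleton_left]
    exact fun h => G.acyclic j (Relation.TransGen.single h.1)
  · simp
  · refine M.condIndepCoords_law_of_mech_eq hij fun x v w hvw => ?_
    rw [hcon x v (Function.update v i (w i)) fun k hk => (Function.update_of_ne hk _ _).symm]
    congr 1
    funext k
    by_cases hk : (k : Fin n) = i
    · simp [coords, hk]
    · simpa [coords, hk] using hvw k ⟨k.2, hk⟩

/-! ### Mechanisms are determined by interventional densities -/

/-- With `r` the quotient of the full products, `a i = r * b i` for all `i`. Multiplying over `i`
gives `r ^ n = r`, so `r = 1`, as `r > 0` and `n ≥ 2`. -/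
theorem eq_of_prod_erase_eq {n : ℕ} (hn : 2 ≤ n) {a b : Fin n → ℝ} (ha : ∀ i, 0 < a i)
    (hb : ∀ i, 0 < b i)
    (h : ∀ i, ∏ l ∈ Finset.univ.erase i, a l = ∏ l ∈ Finset.univ.erase i, b l) : a = b := by
  have hA : 0 < ∏ i, a i := Finset.prod_pos fun i _ => ha i
  have hB : 0 < ∏ i, b i := Finset.prod_pos fun i _ => hb i
  let r := (∏ i, a i) / ∏ i, b i
  have hr : 0 < r := div_pos hA hB
  have hab : ∀ i, a i = r * b i := fun i => by
    have h₁ := Finset.mul_prod_erase Finset.univ a (Finset.mem_univ i)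
    have h₂ := Finset.mul_prod_erase Finset.univ b (Finset.mem_univ i)
    have h₃ : 0 < ∏ l ∈ Finset.univ.erase i, b l := Finset.prod_pos fun l _ => hb l
    have h₄ := hb i
    simp only [r]
    rw [← h₁, ← h₂, h i]
    field_simp
  have hpow : r ^ n * ∏ i, b i = r * ∏ i, b i := by
    have h₁ : ∏ i, a i = r ^ n * ∏ i, b i := by
      rw [Finset.prod_congr rfl fun i _ => hab i, Finset.prod_mul_distrib]
      simp
    rw [← h₁]
    exact (div_mul_cancel₀ _ hB.ne').symm
  have hrn : r ^ n = r := mul_right_cancel₀ hB.ne' hpow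
  have hr1 : r ^ (n - 1) = 1 := by
    refine mul_right_cancel₀ hr.ne' ?_
    rw [← pow_succ, Nat.sub_add_cancel (by omega), hrn, one_mul]
  have : r = 1 := (pow_eq_one_iff_of_nonneg hr.le (by omega)).1 hr1
  funext i
  rw [hab i, this, one_mul]

namespace CausalModel

variable {n : ℕ} {G G' : DAG n}

/-- The mechanism of node `i` as a function of all variables. -/
def mechAt (M : CausalModel G) (i : Fin n) (v : Fin n → ℝ) : ℝ :=
  M.mech i (v i) (coords (G.parents i) v)

theorem mechAt_nonneg (M : CausalModel G) (i : Fin n) (v : Fin n → ℝ) : 0 ≤ M.mechAt i v :=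
  (M.isCondDensity i).nonneg _ _

theorem mechAt_congr (M : CausalModel G) {i : Fin n} {v w : Fin n → ℝ} (hi : v i = w i)
    (hpa : ∀ j ∈ G.parents i, v j = w j) : M.mechAt i v = M.mechAt i w := by
  have : coords (G.parents i) v = coords (G.parents i) w := funext fun j => hpa j j.2
  rw [mechAt, mechAt, hi, this]

theorem density_intervene_of_targets_eq (M : CausalModel G) {I : PerfectIntervention n}
    {i : Fin n} (hI : I.targets = {i}) (v : Fin n → ℝ) :
    (M.intervene I).density v = I.mech i (v i) * ∏ l ∈ Finset.univ.erase i, M.mechAt l v := by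
  rw [density, ← Finset.mul_prod_erase _ _ (Finset.mem_univ i)]
  congr 1
  · simp [intervene, hI]
  · refine Finset.prod_congr rfl fun l hl => ?_
    have : l ∉ I.targets := by simpa [hI] using Finset.ne_of_mem_erase hl
    simp [intervene, this, mechAt]

/-- Integrating out all variables but the `i`-th one. -/
theorem lmarginal_mul_prod_mechAt (M : CausalModel G) (i : Fin n) {a : ℝ → ℝ}
    (ha : ∀ x, 0 ≤ a x) (v : Fin n → ℝ) :
    (∫⋯∫⁻_Finset.univ.erase i, (fun w => ENNReal.ofReal
      (a (w i) * ∏ l ∈ Finset.univ.erase i, M.mechAt l w)) ∂fun _ => (volume : Measure ℝ)) v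
      = ENNReal.ofReal (a (v i)) := by
  have h : (fun w => ENNReal.ofReal (a (w i) * ∏ l ∈ Finset.univ.erase i, M.mechAt l w))
      = fun w => ENNReal.ofReal (a (w i)) * ∏ l ∈ Finset.univ.erase i, M.emech l w := by
    funext w
    rw [ENNReal.ofReal_mul (ha _), ENNReal.ofReal_prod_of_nonneg fun l _ => M.mechAt_nonneg l w]
    rfl
  rw [h, lmarginal_mul_left_of_forall_eq _ _ (M.measurable_prod_emech _)]
  · refine (congrArg _ (M.lmarginal_prod_mech _ v)).trans (mul_one _)
  · intro v w hvw
    rw [hvw i (by simp)]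

/-- Two causal models with the same interventional densities for perfect interventions on each
of at least two nodes have the same mechanisms. -/
theorem mechAt_eq_of_forall_mul_prod_eq (hn : 2 ≤ n) (M : CausalModel G) (N : CausalModel G')
    {a b : Fin n → ℝ → ℝ} (ha : ∀ i x, 0 ≤ a i x) (hb : ∀ i x, 0 ≤ b i x)
    (hpos : ∀ i v, 0 < a i (v i) * ∏ l ∈ Finset.univ.erase i, M.mechAt l v)
    (h : ∀ i v, a i (v i) * ∏ l ∈ Finset.univ.erase i, M.mechAt l v
      = b i (v i) * ∏ l ∈ Finset.univ.erase i, N.mechAt l v) (i : Fin n) (v : Fin n → ℝ) :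
    M.mechAt i v = N.mechAt i v := by
  have hab : ∀ i x, a i x = b i x := fun i x => by
    have h₁ := M.lmarginal_mul_prod_mechAt i (ha i) fun _ => x
    rw [funext fun w => congrArg ENNReal.ofReal (h i w),
      N.lmarginal_mul_prod_mechAt i (hb i) fun _ => x] at h₁
    exact ((ENNReal.ofReal_eq_ofReal_iff (hb i x) (ha i x)).1 h₁).symm
  -- An intervention on `i` removes the mechanism of `i`, so its positivity has to be read off from
  -- an intervention on another node.
  have hne : ∀ i : Fin n, ∃ k : Fin n, i ∈ Finset.univ.erase k := fun i => by
    have : Nontrivial (Fin n) := Fin.nontrivial_iff_two_le.2 hn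
    obtain ⟨k, hk⟩ := exists_ne i
    exact ⟨k, by simpa using hk.symm⟩
  have posM : ∀ i, 0 < M.mechAt i v := fun i => by
    obtain ⟨k, hk⟩ := hne i
    refine (M.mechAt_nonneg i v).lt_of_ne' fun h0 => (hpos k v).ne' ?_
    rw [Finset.prod_eq_zero hk h0, mul_zero]
  have posN : ∀ i, 0 < N.mechAt i v := fun i => by
    obtain ⟨k, hk⟩ := hne i
    refine (N.mechAt_nonneg i v).lt_of_ne' fun h0 => (hpos k v).ne' ?_
    rw [h, Finset.prod_eq_zero hk h0, mul_zero]
  refine congrFun (eq_of_prod_erase_eq hn posM posN fun k => ?_) i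
  have h₁ := h k v
  rw [← hab] at h₁
  exact mul_left_cancel₀ (left_ne_zero_of_mul (hpos k v).ne') h₁

/-- Every mechanism depends on every parent. -/
def IsMinimal (M : CausalModel G) : Prop :=
  ∀ i j, G.graph.Adj i j → ∃ v w : Fin n → ℝ, (∀ k, k ≠ i → v k = w k) ∧
    M.mechAt j v ≠ M.mechAt j w

theorem isMinimal_of_isFaithful (M : CausalModel G) (hM : IsFaithful G M.law) : M.IsMinimal := by
  intro i j hij
  obtain ⟨x, v, w, hvw, hne⟩ := M.exists_mech_ne_of_isFaithful hM hij
  -- A node is not its own parent, so its value can be set to `x` without affecting the parents.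
  have hj : ∀ u : Fin n → ℝ, M.mechAt j (Function.update u j x)
      = M.mech j x (coords (G.parents j) u) := fun u => by
    have : coords (G.parents j) (Function.update u j x) = coords (G.parents j) u :=
      funext fun k => Function.update_of_ne
        (ne_of_mem_of_not_mem k.2 fun h => G.acyclic j (Relation.TransGen.single h)) _ _
    rw [mechAt, this, Function.update_self]
  refine ⟨Function.update v j x, Function.update w j x, fun k hk => ?_, by rwa [hj, hj]⟩
  by_cases hkj : k = j
  · subst hkj; simp
  · simpa [hkj] using hvw k hk

/-- The common mechanism of `j` varies with the `i`-th variable, but in `N` it reads only `j` and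
the `G'`-parents of `j`. -/
theorem IsMinimal.adj_of_mechAt_eq {M : CausalModel G} (hM : M.IsMinimal) {N : CausalModel G'}
    (h : ∀ i v, M.mechAt i v = N.mechAt i v) {i j : Fin n} (hij : G.graph.Adj i j) :
    G'.graph.Adj i j := by
  obtain ⟨v, w, hvw, hne⟩ := hM i j hij
  by_contra hcon
  refine hne ?_
  rw [h, h]
  refine N.mechAt_congr (hvw j fun hji => ?_) fun k hk => hvw k fun hki => hcon (hki ▸ hk)
  exact G.acyclic j (Relation.TransGen.single (hji ▸ hij))

end CausalModel

/-! ### Pulling a causal model back along an element-wise map and a permutation -/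

/-- The DAG obtained by relabelling the nodes. -/
def DAG.relabel {n : ℕ} (G : DAG n) (π : Equiv.Perm (Fin n)) : DAG n where
  graph := { Adj := fun i j => G.graph.Adj (π i) (π j) }
  acyclic i hi := G.acyclic (π i) (Relation.TransGen.lift π (fun _ _ h => h) _ _ hi)

/-- The map `v ↦ P_{π⁻¹} (φ v)`. -/
def permMap {n : ℕ} (π : Equiv.Perm (Fin n)) (φ : Fin n → ℝ → ℝ) (v : Fin n → ℝ) : Fin n → ℝ :=
  fun k => φ (π.symm k) (v (π.symm k))

theorem lintegral_abs_deriv_mul_comp {φ : ℝ → ℝ} (hφ : Differentiable ℝ φ)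
    (hbij : Function.Bijective φ) (g : ℝ → ENNReal) :
    ∫⁻ x, ENNReal.ofReal |deriv φ x| * g (φ x) = ∫⁻ x, g x := by
  have h := lintegral_image_eq_lintegral_abs_deriv_mul (f := φ) (f' := deriv φ) MeasurableSet.univ
    (fun x _ => (hφ x).hasDerivAt.hasDerivWithinAt) hbij.injective.injOn g
  rw [Set.image_univ, hbij.surjective.range_eq, Measure.restrict_univ] at h
  exact h.symm

namespace CausalModel

variable {n : ℕ} {G : DAG n}

/-- The causal model of the variables `v`, where `permMap π φ v` follows the model `M`. -/
noncomputable def relabel (M : CausalModel G) (π : Equiv.Perm (Fin n)) (φ : Fin n → ℝ → ℝ)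
    (hφ : ∀ i, Differentiable ℝ (φ i)) (hbij : ∀ i, Function.Bijective (φ i)) :
    CausalModel (G.relabel π) where
  mech i x a := |deriv (φ i) x| * M.mech (π i) (φ i x) fun k : G.parents (π i) =>
    φ (π.symm k) (a ⟨π.symm k, show G.graph.Adj (π (π.symm k)) (π i) by
      rw [Equiv.apply_symm_apply]; exact k.2⟩)
  isCondDensity i :=
    { measurable := by
        refine ((measurable_deriv _).abs.comp measurable_fst).mul
          ((M.isCondDensity (π i)).measurable.comp
            (((hφ i).continuous.measurable.comp measurable_fst).prodMk ?_))
        exact measurable_pi_lambda _ fun k => (hφ _).continuous.measurable.comp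
          ((measurable_pi_apply _).comp measurable_snd)
      nonneg := fun x a => mul_nonneg (abs_nonneg _) ((M.isCondDensity _).nonneg _ _)
      lintegral_eq_one := fun a => by
        simp_rw [ENNReal.ofReal_mul (abs_nonneg _)]
        refine (lintegral_abs_deriv_mul_comp (hφ i) (hbij i) fun y => ENNReal.ofReal
          (M.mech (π i) y _)).trans ((M.isCondDensity (π i)).lintegral_eq_one _) }

variable (M : CausalModel G) (π : Equiv.Perm (Fin n)) (φ : Fin n → ℝ → ℝ)
    (hφ : ∀ i, Differentiable ℝ (φ i)) (hbij : ∀ i, Function.Bijective (φ i))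

theorem mechAt_relabel (i : Fin n) (v : Fin n → ℝ) :
    (M.relabel π φ hφ hbij).mechAt i v = |deriv (φ i) (v i)| * M.mechAt (π i) (permMap π φ v) := by
  rw [mechAt, mechAt, show permMap π φ v (π i) = φ i (v i) by simp [permMap]]
  rfl

/-- The Jacobian of an element-wise map is a product with one factor per node. Each factor is
absorbed by the mechanism of its node, the `i`-th one by the intervened mechanism, so the pullback
is again an interventional density of the relabelled model. -/
theorem density_intervene_permMap {I : PerfectIntervention n} {i : Fin n}
    (hI : I.targets = {π i}) (v : Fin n → ℝ) :
    (∏ l, |deriv (φ l) (v l)|) * (M.intervene I).density (permMap π φ v)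
      = |deriv (φ i) (v i)| * I.mech (π i) (φ i (v i))
        * ∏ l ∈ Finset.univ.erase i, (M.relabel π φ hφ hbij).mechAt l v := by
  have hprod : ∏ k ∈ Finset.univ.erase (π i), M.mechAt k (permMap π φ v)
      = ∏ l ∈ Finset.univ.erase i, M.mechAt (π l) (permMap π φ v) := by
    refine (Finset.prod_bij (fun l _ => π l) ?_ ?_ ?_ ?_).symm
    · simp
    · simp
    · intro k hk
      exact ⟨π.symm k, by simpa [Equiv.symm_apply_eq] using hk, by simp⟩
    · simp
  rw [M.density_intervene_of_targets_eq hI, hprod,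
    show permMap π φ v (π i) = φ i (v i) by simp [permMap],
    ← Finset.mul_prod_erase _ _ (Finset.mem_univ i)]
  simp_rw [mechAt_relabel, Finset.prod_mul_distrib]
  ring

theorem IsMinimal.relabel {M : CausalModel G} (hM : M.IsMinimal)
    (hφ' : ∀ i x, deriv (φ i) x ≠ 0) : (M.relabel π φ hφ hbij).IsMinimal := by
  intro i j hij
  obtain ⟨v, w, hvw, hne⟩ := hM (π i) (π j) hij
  choose χ hχ using fun i => (hbij i).surjective
  have hmap : ∀ u : Fin n → ℝ, permMap π φ (fun k => χ k (u (π k))) = u := fun u => by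
    funext k; simp [permMap, hχ]
  have hij' : j ≠ i := fun h => G.acyclic (π j) (Relation.TransGen.single (by
    have hij₂ : G.graph.Adj (π i) (π j) := hij
    rwa [← h] at hij₂))
  refine ⟨fun k => χ k (v (π k)), fun k => χ k (w (π k)), fun k hk => ?_, ?_⟩
  · simp only [hvw (π k) fun h => hk (π.injective h)]
  -- The two points agree at `j`, so the Jacobian factors coincide and, being nonzero, cancel.
  · rw [mechAt_relabel, mechAt_relabel, hmap, hmap, hvw (π j) fun h => hij' (π.injective h)]
    exact fun h => hne (mul_left_cancel₀ (abs_ne_zero.2 (hφ' _ _)) h)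

end CausalModel

/-! ### Change of variables and density ratios -/

/-- The change of variables formula for the densities of two causal models whose laws are related
by an injective `C¹` map. -/
theorem CausalModel.density_eq_abs_det_mul {n : ℕ} {G G' : DAG n} {M : CausalModel G}
    {N : CausalModel G'} (hM : M.IsRegular) (hN : N.IsRegular) {ψ : (Fin n → ℝ) → Fin n → ℝ}
    (hψ : ContDiff ℝ 1 ψ) (hinj : Function.Injective ψ) (hlaw : M.law.map ψ = N.law)
    (v : Fin n → ℝ) : M.density v = |(fderiv ℝ ψ v).det| * N.density (ψ v) := by
  have hemb : MeasurableEmbedding ψ := hψ.continuous.measurableEmbedding hinj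
  let q : (Fin n → ℝ) → ℝ := fun v => |(fderiv ℝ ψ v).det| * N.density (ψ v)
  have hq : Continuous q := by
    refine Continuous.mul ?_ (hN.1.continuous.comp hψ.continuous)
    exact (ContinuousLinearMap.continuous_det.comp (hψ.continuous_fderiv one_ne_zero)).abs
  have hq0 : ∀ v, 0 ≤ q v := fun v => mul_nonneg (abs_nonneg _) (hN.2 _).le
  have hlawq : volume.withDensity (fun v => ENNReal.ofReal (M.density v))
      = volume.withDensity fun v => ENNReal.ofReal (q v) := by
    ext s hs
    have h₁ : M.law s = N.law (ψ '' s) := by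
      rw [← hlaw, hemb.map_apply, Set.preimage_image_eq _ hinj]
    rw [← CausalModel.law, h₁, CausalModel.law, withDensity_apply _ (hemb.measurableSet_image.2 hs),
      lintegral_image_eq_lintegral_abs_det_fderiv_mul volume hs
        (fun x _ => ((hψ.differentiable one_ne_zero) x).hasFDerivAt.hasFDerivWithinAt)
        hinj.injOn, withDensity_apply _ hs]
    simp_rw [q, ENNReal.ofReal_mul (abs_nonneg _)]
  rw [withDensity_eq_iff_of_sigmaFinite hM.1.continuous.measurable.ennreal_ofReal.aemeasurable
    hq.measurable.ennreal_ofReal.aemeasurable] at hlawq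
  -- Equal laws give equality almost everywhere only; continuity of both sides upgrades it to every
  -- point.
  have hae : M.density =ᵐ[volume] q := by
    filter_upwards [hlawq] with w hw
    exact (ENNReal.ofReal_eq_ofReal_iff (hM.2 w).le (hq0 w)).1 hw
  exact congrFun ((hM.1.continuous.ae_eq_iff_eq volume hq).1 hae) v

theorem CausalModel.density_intervene_div {n : ℕ} {G : DAG n} (M : CausalModel G)
    {I J : PerfectIntervention n} {i : Fin n} (hI : I.targets = {i}) (hJ : J.targets = {i})
    (hreg : (M.intervene I).IsRegular) (v : Fin n → ℝ) :
    (M.intervene J).density v / (M.intervene I).density v = J.mech i (v i) / I.mech i (v i) := by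
  have h := (hreg.2 v).ne'
  rw [M.density_intervene_of_targets_eq hI] at h
  rw [M.density_intervene_of_targets_eq hI, M.density_intervene_of_targets_eq hJ,
    mul_div_mul_right _ _ (right_ne_zero_of_mul h)]

theorem CausalModel.differentiable_mech_div {n : ℕ} {G : DAG n} (M : CausalModel G)
    {I J : PerfectIntervention n} {i : Fin n} (hI : I.targets = {i}) (hJ : J.targets = {i})
    (hregI : (M.intervene I).IsRegular) (hregJ : (M.intervene J).IsRegular) :
    Differentiable ℝ fun y => J.mech i y / I.mech i y := by
  -- Restricting to the diagonal writes the ratio as a quotient of joint densities, so no smoothness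
  -- of the individual mechanisms is needed.
  have hconst : Differentiable ℝ fun (y : ℝ) (_ : Fin n) => y :=
    differentiable_pi.2 fun _ => differentiable_id
  have h := ((hregJ.1.differentiable one_ne_zero).comp hconst).div
    ((hregI.1.differentiable one_ne_zero).comp hconst) fun y => (hregI.2 _).ne'
  exact (funext fun y => M.density_intervene_div hI hJ hregI fun _ => y) ▸ h

/-! ### Maps with components depending on one variable -/

section Elementwise

variable {n : ℕ} {ψ : (Fin n → ℝ) → Fin n → ℝ}

theorem deriv_mul_eq_of_comp_eq (hψ : Differentiable ℝ ψ) {r r' : ℝ → ℝ}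
    (hr : Differentiable ℝ r) (hr' : Differentiable ℝ r') {i k : Fin n}
    (h : ∀ v, r (v i) = r' (ψ v k)) (v u : Fin n → ℝ) :
    deriv r (v i) * u i = deriv r' (ψ v k) * fderiv ℝ ψ v u k := by
  have h₀ : HasFDerivAt (fun v : Fin n → ℝ => v i)
      (ContinuousLinearMap.proj (R := ℝ) (φ := fun _ => ℝ) i) v := hasFDerivAt_apply i v
  have h₁ : HasFDerivAt (fun v : Fin n → ℝ => r (v i)) _ v :=
    (hr (v i)).hasDerivAt.comp_hasFDerivAt v h₀
  have h₂ : HasFDerivAt (fun v : Fin n → ℝ => r' (ψ v k)) _ v :=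
    (hr' (ψ v k)).hasDerivAt.comp_hasFDerivAt v (hasFDerivAt_pi'.1 (hψ v).hasFDerivAt k)
  rw [← funext h] at h₂
  simpa using congrArg (fun L => L u) (h₁.unique h₂)

/-- A component whose image under some function is a function of the `i`-th variable with
nonvanishing derivative depends on the `i`-th variable only. -/
theorem eq_of_comp_eq (hψ : Differentiable ℝ ψ) {r r' : ℝ → ℝ}
    (hr : Differentiable ℝ r) (hr' : Differentiable ℝ r') (hr0 : ∀ x, deriv r x ≠ 0) {i k : Fin n}
    (h : ∀ v, r (v i) = r' (ψ v k)) {v w : Fin n → ℝ} (hvw : v i = w i) : ψ v k = ψ w k := by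
  have hk := deriv_mul_eq_of_comp_eq hψ hr hr' h
  -- The direction `eᵢ` shows that `deriv r'` is nonzero on the values of the component; directions
  -- with `u i = 0` then show that its other partial derivatives vanish. The segment from `v` to `w`
  -- runs in such a direction.
  have hr0' : ∀ v, deriv r' (ψ v k) ≠ 0 := fun v h0 => hr0 (v i) <| by
    simpa [h0] using hk v (Pi.single i 1)
  have hzero : ∀ v u : Fin n → ℝ, u i = 0 → fderiv ℝ ψ v u k = 0 := fun v u hu => by
    have := hk v u
    rw [hu, mul_zero] at this
    exact (mul_eq_zero.1 this.symm).resolve_left (hr0' v)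
  have hline : ∀ t : ℝ, HasDerivAt (fun t : ℝ => ψ (v + t • (w - v)) k) 0 t := fun t => by
    have h₁ : HasDerivAt (fun t : ℝ => v + t • (w - v)) (w - v) t := by
      simpa using ((hasDerivAt_id t).smul_const (w - v)).const_add v
    have h₂ := hasDerivAt_pi.1 ((hψ (v + t • (w - v))).hasFDerivAt.comp_hasDerivAt t h₁) k
    rwa [hzero _ _ (by simp [hvw])] at h₂
  have := is_const_of_deriv_eq_zero (fun t => (hline t).differentiableAt)
    (fun t => (hline t).deriv) 0 1
  simpa using this

/-- Permuting the rows of the Jacobian matrix by `π` makes it diagonal; the sign of `π` disappears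
in the absolute value. -/
theorem abs_det_fderiv_eq_prod (hψ : Differentiable ℝ ψ) {π : Equiv.Perm (Fin n)}
    {φ : Fin n → ℝ → ℝ} (hφ : ∀ i, Differentiable ℝ (φ i)) (h : ∀ v i, ψ v (π i) = φ i (v i))
    (v : Fin n → ℝ) : |(fderiv ℝ ψ v).det| = ∏ i, |deriv (φ i) (v i)| := by
  have hcomp : ∀ u i, fderiv ℝ ψ v u (π i) = deriv (φ i) (v i) * u i := fun u i => by
    have := deriv_mul_eq_of_comp_eq hψ (hφ i) differentiable_id (k := π i) (fun v => (h v i).symm)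
      v u
    simpa using this.symm
  let A : Matrix (Fin n) (Fin n) ℝ := LinearMap.toMatrix' (fderiv ℝ ψ v : (Fin n → ℝ) →ₗ[ℝ] _)
  have hA : A.submatrix π id = Matrix.diagonal fun i => deriv (φ i) (v i) := by
    ext a b
    simp only [A, Matrix.submatrix_apply, id, LinearMap.toMatrix'_apply,
      ContinuousLinearMap.coe_coe, hcomp, Matrix.diagonal_apply]
    by_cases hab : a = b <;> simp [hab]
  have hdet := Matrix.det_permute π A
  rw [hA, Matrix.det_diagonal] at hdet
  rw [ContinuousLinearMap.det, ← LinearMap.det_toMatrix', ← Finset.abs_prod, hdet, abs_mul]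
  rcases Int.units_eq_one_or (Equiv.Perm.sign π) with hs | hs <;> simp [hs, A]

end Elementwise

/-! ### Identification of the graph and of the latent variables -/

/-- A diffeomorphism that relates the interventional densities of two minimal causal models
and acts element-wise up to a permutation is a graph isomorphism. -/
theorem CausalModel.adj_iff_of_permMap {n : ℕ} {G G' : DAG n} {P : CausalModel G}
    {Q : CausalModel G'} (hP : P.IsMinimal) (hQ : Q.IsMinimal) {π : Equiv.Perm (Fin n)}
    {φ : Fin n → ℝ → ℝ} (hφ : ∀ i, Differentiable ℝ (φ i))
    (hbij : ∀ i, Function.Bijective (φ i)) (hφ' : ∀ i x, deriv (φ i) x ≠ 0)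
    (I I' : Fin n → PerfectIntervention n) (hI : ∀ i, (I i).targets = {i})
    (hI' : ∀ i, (I' i).targets = {π i}) (hpos : ∀ i v, 0 < (P.intervene (I i)).density v)
    (h : ∀ i v, (P.intervene (I i)).density v
      = (∏ l, |deriv (φ l) (v l)|) * (Q.intervene (I' i)).density (permMap π φ v))
    (i j : Fin n) : G.graph.Adj i j ↔ G'.graph.Adj (π i) (π j) := by
  -- With fewer than two nodes there are no edges; the comparison of mechanisms needs `n ≥ 2`.
  rcases lt_or_ge n 2 with hn | hn
  · have : Subsingleton (Fin n) := Fin.subsingleton_iff_le_one.2 (by omega)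
    rw [Subsingleton.elim i j]
    exact iff_of_false (fun h => G.acyclic j (.single h)) (fun h => G'.acyclic (π j) (.single h))
  let N := Q.relabel π φ hφ hbij
  have hmech : ∀ i v, P.mechAt i v = N.mechAt i v := by
    refine P.mechAt_eq_of_forall_mul_prod_eq hn N (a := fun i => (I i).mech i)
      (b := fun i x => |deriv (φ i) x| * (I' i).mech (π i) (φ i x))
      (fun i x => ((I i).isDensity i).nonneg x)
      (fun i x => mul_nonneg (abs_nonneg _) (((I' i).isDensity _).nonneg _)) ?_ ?_
    · intro i v
      rw [← P.density_intervene_of_targets_eq (hI i)]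
      exact hpos i v
    · intro i v
      rw [← P.density_intervene_of_targets_eq (hI i), h,
        Q.density_intervene_permMap π φ hφ hbij (hI' i)]
  exact ⟨fun hij => hP.adj_of_mechAt_eq (G' := G'.relabel π) hmech hij, fun hij =>
    (hQ.relabel π φ hφ hbij hφ').adj_of_mechAt_eq (G := G'.relabel π)
      (fun i v => (hmech i v).symm) hij⟩
theorem mainTheorem2 {n d m : ℕ}
    -- the ground truth: causal graph, causal mechanisms, and mixing function with its inverse
    (G : DAG n) (P : CausalModel G) (hP : IsFaithful G P.law)
    (f : (Fin n → ℝ) → (Fin d → ℝ)) (finv : (Fin d → ℝ) → (Fin n → ℝ))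
    (hf : IsDiffeoOntoImage f finv)
    -- `m` pairs of environments: those of the `j`-th pair are `e j false` and `e j true`
    (e : Fin m → Bool → PerfectIntervention n)
    (he_reg : ∀ j b, (P.intervene (e j b)).IsRegular)
    -- the two environments of each pair are single-node interventions on the same node
    (he_pair : ∀ j, ∃ i, ∀ b, (e j b).targets = {i})
    -- for each node, some pair targets it, by two everywhere distinct interventions
    (he_cover : ∀ i, ∃ j, (∀ b, (e j b).targets = {i}) ∧
      ∀ x, deriv (fun y => (e j true).mech i y / (e j false).mech i y) x ≠ 0)
    -- the candidate: causal graph, causal mechanisms, and unmixing function with its inverse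
    (G' : DAG n) (Q : CausalModel G') (hQ : IsFaithful G' Q.law)
    (h : (Fin d → ℝ) → (Fin n → ℝ)) (hinv : (Fin n → ℝ) → (Fin d → ℝ))
    (hh : IsDiffeoOntoImage hinv h) (hh_range : Set.range hinv = Set.range f)
    (e' : Fin m → Bool → PerfectIntervention n)
    (he'_reg : ∀ j b, (Q.intervene (e' j b)).IsRegular)
    (he'_pair : ∀ j, ∃ k, ∀ b, (e' j b).targets = {k})
    -- the candidate's latent distributions are the push-forwards of the observed distributions
    (h_law : ∀ j b, ((P.intervene (e j b)).law.map f).map h = (Q.intervene (e' j b)).law) :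
    CRLEquiv (Set.range f) (finv, G) (h, G') := by

  have hmem : ∀ v, f v ∈ Set.range hinv := fun v => hh_range ▸ Set.mem_range_self v
  have hmem' : ∀ z, hinv z ∈ Set.range f := fun z => hh_range ▸ Set.mem_range_self z
  let ψ : (Fin n → ℝ) → Fin n → ℝ := h ∘ f
  let χ : (Fin n → ℝ) → Fin n → ℝ := finv ∘ hinv
  have hψ : ContDiff ℝ 1 ψ := hh.contDiffOn_inverse.comp_contDiff hf.contDiff hmem
  have hχ : ContDiff ℝ 1 χ := hf.contDiffOn_inverse.comp_contDiff hh.contDiff hmem'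
  have hχψ : ∀ v, χ (ψ v) = v := fun v => by
    obtain ⟨z, hz⟩ := hmem v
    change finv (hinv (h (f v))) = v
    rw [← hz, hh.leftInverse, hz, hf.leftInverse]
  have hψχ : ∀ z, ψ (χ z) = z := fun z => by
    obtain ⟨v, hv⟩ := hmem' z
    change h (f (finv (hinv z))) = z
    rw [← hv, hf.leftInverse, hv, hh.leftInverse]
  have hψinj : Function.Injective ψ := Function.LeftInverse.injective hχψ
  have hψd : Differentiable ℝ ψ := hψ.differentiable one_ne_zero
  have hlaw : ∀ j b, (P.intervene (e j b)).law.map ψ = (Q.intervene (e' j b)).law := by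
    intro j b
    -- Nothing is known about `h` off the image, but were it not a.e. measurable, its push-forward
    -- would be the zero measure by convention, not a probability law.
    have hmeas : AEMeasurable h ((P.intervene (e j b)).law.map f) := by
      by_contra hcon
      have h0 := h_law j b
      rw [Measure.map_of_not_aemeasurable hcon] at h0
      exact IsProbabilityMeasure.ne_zero _ h0.symm
    rw [← h_law, AEMeasurable.map_map_of_aemeasurable hmeas
      hf.contDiff.continuous.measurable.aemeasurable]
  have hdens := fun j b => CausalModel.density_eq_abs_det_mul (he_reg j b) (he'_reg j b) hψ hψinj
    (hlaw j b)
  choose τ hτ hτ' using he_cover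
  choose k hk using he'_pair
  let r : Fin n → ℝ → ℝ := fun i y => (e (τ i) true).mech i y / (e (τ i) false).mech i y
  let r' : Fin n → ℝ → ℝ := fun i y =>
    (e' (τ i) true).mech (k (τ i)) y / (e' (τ i) false).mech (k (τ i)) y
  have hr : ∀ i, Differentiable ℝ (r i) := fun i =>
    P.differentiable_mech_div (hτ i _) (hτ i _) (he_reg _ _) (he_reg _ _)
  have hr' : ∀ i, Differentiable ℝ (r' i) := fun i =>
    Q.differentiable_mech_div (hk _ _) (hk _ _) (he'_reg _ _) (he'_reg _ _)
  have hrr' : ∀ i v, r i (v i) = r' i (ψ v (k (τ i))) := by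
    intro i v
    have h₁ := P.density_intervene_div (hτ i false) (hτ i true) (he_reg _ _) v
    have h₂ := Q.density_intervene_div (hk (τ i) false) (hk (τ i) true) (he'_reg _ _) (ψ v)
    have hdet : |(fderiv ℝ ψ v).det| ≠ 0 := fun h0 => by
      have := ((he_reg (τ i) false).2 v).ne'
      rw [hdens, h0, zero_mul] at this
      exact this rfl
    rw [hdens, hdens, mul_div_mul_left _ _ hdet, h₂] at h₁
    exact h₁.symm
  have hchain := fun i => deriv_mul_eq_of_comp_eq hψd (hr i) (hr' i) (hrr' i)
  -- If distinct `i` and `i'` shared a component, the relation for `i'` in the direction `eᵢ` would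
  -- make either `deriv (r' i')` or the `i`-th partial derivative of that component vanish. The
  -- first contradicts `deriv (r i') ≠ 0`, the second `deriv (r i) ≠ 0`.
  have hkinj : Function.Injective fun i => k (τ i) := by
    intro i i' hii'
    by_contra hne
    have h₁ := hchain i 0 (Pi.single i 1)
    have h₂ := hchain i' 0 (Pi.single i 1)
    have h₃ : deriv (r i) 0 ≠ 0 := hτ' i 0
    rw [Pi.single_eq_of_ne (Ne.symm hne), mul_zero, ← show k (τ i) = k (τ i') from hii'] at h₂
    rcases mul_eq_zero.1 h₂.symm with h₄ | h₄
    · have h₅ := hchain i' 0 (Pi.single i' 1)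
      rw [← show k (τ i) = k (τ i') from hii', h₄] at h₅
      exact hτ' i' 0 (by simpa using h₅)
    · rw [h₄] at h₁
      exact h₃ (by simpa using h₁)
  let π : Equiv.Perm (Fin n) := Equiv.ofBijective _ (Finite.injective_iff_bijective.1 hkinj)
  -- The component `π i` will depend on the `i`-th variable only, so the diagonal serves as a choice
  -- of the other coordinates.
  let φ : Fin n → ℝ → ℝ := fun i x => ψ (fun _ => x) (π i)
  have hconst : ContDiff ℝ 1 fun (x : ℝ) (_ : Fin n) => x := contDiff_pi.2 fun _ => contDiff_id
  have hφ : ∀ i, ContDiff ℝ 1 (φ i) := fun i => contDiff_pi.1 (hψ.comp hconst) (π i)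
  have hφd : ∀ i, Differentiable ℝ (φ i) := fun i => (hφ i).differentiable one_ne_zero
  have hψφ : ∀ v i, ψ v (π i) = φ i (v i) := fun v i =>
    eq_of_comp_eq hψd (hr i) (hr' i) (hτ' i) (hrr' i) rfl
  have hψperm : ∀ v, permMap π φ v = ψ v := fun v => by
    funext l
    rw [permMap, ← hψφ, Equiv.apply_symm_apply]
  let θ : Fin n → ℝ → ℝ := fun i y => χ (fun _ => y) i
  have hφθ : ∀ i, Function.RightInverse (θ i) (φ i) := fun i y => by
    simp only [θ]
    rw [← hψφ, hψχ]
  have hφinj : ∀ i, Function.Injective (φ i) := fun i x y hxy => by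
    have : (fun _ => x : Fin n → ℝ) = Function.update (fun _ => x) i y := by
      apply hψinj
      rw [← hψperm, ← hψperm]
      funext l
      by_cases hl : π.symm l = i
      · simp [permMap, hl, hxy]
      · simp [permMap, hl]
    simpa using congrFun this i
  have hθφ : ∀ i, Function.LeftInverse (θ i) (φ i) := fun i =>
    (hφθ i).leftInverse_of_injective (hφinj i)
  have hbij : ∀ i, Function.Bijective (φ i) := fun i => ⟨hφinj i, (hφθ i).surjective⟩
  have hdet : ∀ v, |(fderiv ℝ ψ v).det| = ∏ i, |deriv (φ i) (v i)| :=
    abs_det_fderiv_eq_prod hψd hφd hψφ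
  -- A zero derivative would make the Jacobian, and with it a positive density, vanish.
  have hφ' : ∀ i x, deriv (φ i) x ≠ 0 := fun i x h0 => by
    have := ((he_reg (τ i) false).2 fun _ => x).ne'
    rw [hdens, hdet, Finset.prod_eq_zero (Finset.mem_univ i) (by simp [h0]), zero_mul] at this
    exact this rfl
  refine ⟨fun i => ⟨φ i, θ i, hθφ i, hφθ i⟩, π, fun i => ⟨hφ i, ?_⟩, ?_, ?_⟩
  · exact contDiff_pi.1 (hχ.comp hconst) i
  · refine CausalModel.adj_iff_of_permMap (P.isMinimal_of_isFaithful hP)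
      (Q.isMinimal_of_isFaithful hQ) hφd hbij hφ' (fun i => e (τ i) false)
      (fun i => e' (τ i) false) (fun i => hτ i _) (fun i => hk _ _)
      (fun i v => (he_reg _ _).2 v) fun i v => ?_
    rw [hdens, hdet, hψperm]
  · rintro _ ⟨v, rfl⟩ l
    change ψ v l = φ (π.symm l) (finv (f v) (π.symm l))
    rw [hf.leftInverse, ← hψφ, Equiv.apply_symm_apply]
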